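/- Let $E$ be a countable set and let $(X_t)_{t\ge 0}$ be an irreducible, transient continuous-time Markov chain on $E$ with jump rates $r(x,y)\ge 0$, $x\ne y$ (with $\sum_y r(x,y)<\infty$ for every $x$), whose trajectories are right-continuous with left limits in the discrete space $E$ (in particular, the chain does not explode). Let $\mathbb P_x$, $\mathbb E_x$ be the law and the expectation of the chain started at $x$. Transience means that, for every $x$, the set $\{t\ge 0: X_t=x\}$ is $\mathbb P_x$-almost surely bounded. Let $\mu$ be a stationary state, that is, a nonzero measure on $E$, finite at each point but possibly of infinite total mass, such that $\sum_x \mu(x)\,\mathbb P_x[X_t=y]=\mu(y)$ for all $t\ge0$, $y\in E$. Let $$(Lf)(x)=\sum_{y} r(x,y)[f(y)-f(x)],\qquad (L^*f)(x)=\sum_{y} r^*(x,y)[f(y)-f(x)],\qquad S=\tfrac12(L+L^*),$$ where $r^*$ is given by $\mu(x)r(x,y)=\mu(y)r^*(y,x)$, let $\langle f,g\rangle_\mu=\sum_x\mu(x)f(x)g(x)$, and let $G(x,y)=\mathbb E_x\big[\int_0^\infty \mathbf 1\{X_t=y\}\,dt\big]$ be the Green function. Let $f:E\to\mathbb R$ be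 finitely supported and let $\{A_n\}$ be an increasing sequence of finite sets with $E=\bigcup_n A_n$. Then, for every $x\in E$, the limit below exists in $[-\infty,\infty]$ and $$\mu(x)\,f(x)^2\;\le\;G(x,x)\,\lim_{n\to\infty}\ \sup_{H\in\mathfrak B_n}\Big\{2\langle L^*f,H\rangle_\mu-\langle H,(-S)H\rangle_\mu\Big\},$$ where $\mathfrak B_n$ is the set of functions $H:E\to\mathbb R$ which vanish off $A_n$. -/

import Mathlib

open MeasureTheory Filter Topology
open scoped NNReal ENNReal

namespace MarkovChain

/-- Jump rates `r(x,y)` of a continuous-time Markov chain on `E`: nonnegative, zero on the diagonal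
and with finite holding rates `λ(x) = ∑ y, r(x,y)`. -/
structure JumpRates (E : Type*) where
  rate : E → E → ℝ≥0
  rate_self : ∀ x, rate x x = 0
  summable_rate : ∀ x, Summable (rate x)

/-- The operator `(L f)(x) = ∑ y, r(x,y) (f(y) - f(x))`. The series converges
absolutely when `f` is bounded and `∑ y, r(x,y) < ∞`. -/
noncomputable def generator {E : Type*} (r : E → E → ℝ≥0) (f : E → ℝ) (x : E) : ℝ :=
  ∑' y, (r x y : ℝ) * (f y - f x)

/-- The jump rates `r*` of the time-reversed process, determined by
`μ(x) r(x,y) = μ(y) r*(y,x)`. -/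
noncomputable def adjointRate {E : Type*} (μ : E → ℝ≥0) (r : E → E → ℝ≥0) (x y : E) : ℝ≥0 :=
  μ y * r y x / μ x

/-- `L*`, the generator of the time-reversed process. -/
noncomputable def adjointGenerator {E : Type*} (μ : E → ℝ≥0) (r : E → E → ℝ≥0) :
    (E → ℝ) → E → ℝ :=
  generator (adjointRate μ r)

/-- `S = (L + L*) / 2`, the symmetric part of the generator. -/
noncomputable def symmetricGenerator {E : Type*} (μ : E → ℝ≥0) (r : E → E → ℝ≥0)
    (f : E → ℝ) (x : E) : ℝ :=
  (generator r f x + adjointGenerator μ r f x) / 2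

/-- The scalar product `⟨f, g⟩_μ = ∑ x, μ(x) f(x) g(x)`. -/
noncomputable def pairing {E : Type*} (μ : E → ℝ≥0) (f g : E → ℝ) : ℝ :=
  ∑' x, (μ x : ℝ) * f x * g x

/-- The chain is irreducible: any state is reached from any state along jumps of positive rate. -/
def JumpRates.Irreducible {E : Type*} (Q : JumpRates E) : Prop :=
  ∀ x y, Relation.ReflTransGen (fun a b => 0 < Q.rate a b) x y

/-- The path space `D(ℝ₊, E)`: right-continuous trajectories with left limits in the discrete
space `E`. -/
def PathSpace (E : Type*) : Type _ :=
  {ω : ℝ≥0 → E // (∀ t, ∀ᶠ s in 𝓝[>] t, ω s = ω t) ∧ ∀ t, ∃ a, ∀ᶠ s in 𝓝[<] t, ω s = a}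

/-- The coordinate process `X_t`. -/
def PathSpace.X {E : Type*} (t : ℝ≥0) (ω : PathSpace E) : E := ω.1 t

/-- The σ-algebra on path space generated by `X_u`, `u ≤ s`. -/
@[reducible] def PathSpace.past (E : Type*) (s : ℝ≥0) : MeasurableSpace (PathSpace E) :=
  ⨆ u : Set.Iic s, MeasurableSpace.comap (PathSpace.X u.1) ⊤

/-- The σ-algebra on path space generated by all the coordinates. -/
instance PathSpace.measurableSpace (E : Type*) : MeasurableSpace (PathSpace E) :=
  ⨆ u : ℝ≥0, MeasurableSpace.comap (PathSpace.X u) ⊤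

/-- `P x`, `x ∈ E`, are the laws on path space of the Markov process with jump rates `Q` started
from `x`: the process starts at `x`, has the (time-homogeneous) Markov property, and its
infinitesimal generator is `L` on finitely supported functions. -/
structure IsMarkovProcess {E : Type*} (Q : JumpRates E) (P : E → Measure (PathSpace E)) :
    Prop where
  isProbabilityMeasure : ∀ x, IsProbabilityMeasure (P x)
  start : ∀ x, ∀ᵐ ω ∂(P x), PathSpace.X 0 ω = x
  markov : ∀ (x : E) (s t : ℝ≥0) (y : E) (B : Set (PathSpace E)),
    MeasurableSet[PathSpace.past E s] B →
      P x (B ∩ {ω | PathSpace.X (s + t) ω = y}) =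
        ∫⁻ ω in B, P (PathSpace.X s ω) {ω' | PathSpace.X t ω' = y} ∂(P x)
  hasGenerator : ∀ f : E → ℝ, f.support.Finite → ∀ x,
    Tendsto (fun t : ℝ≥0 => ((∫ ω, f (PathSpace.X t ω) ∂(P x)) - f x) / (t : ℝ))
      (𝓝[>] 0) (𝓝 (generator Q.rate f x))

/-- `μ` is a stationary state of the process: a nonzero measure on `E`, finite at each point but
possibly of infinite total mass, with `∑ x, μ(x) P_x[X_t = y] = μ(y)`. -/
structure IsStationary {E : Type*} (P : E → Measure (PathSpace E)) (μ : E → ℝ≥0) : Prop where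
  ne_zero : μ ≠ 0
  invariant : ∀ (t : ℝ≥0) (y : E),
    ∑' x, (μ x : ℝ≥0∞) * P x {ω | PathSpace.X t ω = y} = μ y

/-- The process is transient: started from any `x`, almost surely the set of times spent at `x`
is bounded. -/
def IsTransient {E : Type*} (P : E → Measure (PathSpace E)) : Prop :=
  ∀ x, ∀ᵐ ω ∂(P x), BddAbove {t : ℝ≥0 | PathSpace.X t ω = x}

/-- The Green function `G(x,y) = E_x[∫₀^∞ 1{X_t = y} dt]`. -/
noncomputable def green {E : Type*} (P : E → Measure (PathSpace E)) (x y : E) : ℝ≥0∞ :=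
  ∫⁻ ω, (∫⁻ t in Set.Ici (0 : ℝ), Set.indicator {s : ℝ | PathSpace.X s.toNNReal ω = y} 1 t) ∂(P x)

/-- The functions `H : E → ℝ` which vanish off `A`. -/
def vanishingOff {E : Type*} (A : Finset E) : Set (E → ℝ) :=
  {H | ∀ y, y ∉ A → H y = 0}

/-- `sup {2 ⟨L* f, H⟩_μ - ⟨H, (-S) H⟩_μ}` over the functions `H` which vanish off `A`, taken in
the extended reals. -/
noncomputable def variationalSup {E : Type*} (μ : E → ℝ≥0) (r : E → E → ℝ≥0) (f : E → ℝ)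
    (A : Finset E) : EReal :=
  ⨆ H ∈ vanishingOff A,
    ((2 * pairing μ (adjointGenerator μ r f) H
      - pairing μ H (-symmetricGenerator μ r H) : ℝ) : EReal)

end MarkovChain

/-! Fix a finite `A` containing `x` and the support of `f`, and let `g` be the Green function with
pole `x` of the process killed outside `A`: `g` vanishes off `A` and `L g = -1_{x}` on `A`. By
adjointness the functional at `H` is `2⟨f, L H⟩ + ⟨H, L H⟩`. On `H = c g` it equals `-μ(x) (2 c f(x)
+ c² g(x))`, whose maximum over `c` is `μ(x) f(x)² / g(x)`. Since `g(x) ≤ G(x,x)`, and the suprema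
increase with `A`, the bound and the limit follow.

Two points need work. Adjointness requires `∑ μ(l) r(l,j) = μ(j) λ(j)`, where `λ(j) = ∑ r(j,z)`,
whereas stationarity is only given for the transition probabilities; differentiating at time zero
yields just `≤`. `IsStationary.hasSum_rate` excludes a loss of mass through infinity: the flow into
`j` from outside a large finite set is controlled by the mass of paths that leave this set before a
fixed time, and this mass vanishes in the limit because a path visits finitely many states in
bounded time.

Existence of `g` and `g(x) ≤ G(x,x)` rest on the comparison `v ≤ P_T v + c ∫₀ᵀ p_s(·,x) ds` for `v ≥
0` with `L v ≥ -c 1_{x}` on `A` (`le_semigroup_add_integral`). Transience makes `P_T v` vanish as `T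
→ ∞`. -/

namespace MarkovChain

variable {E : Type*}

/-! ### Measurability and finiteness on path space -/

namespace PathSpace

lemma measurableSet_past {s t : ℝ≥0} (h : t ≤ s) (S : Set E) :
    MeasurableSet[past E s] {ω | X t ω ∈ S} := by
  have : MeasurableSpace.comap (X (E := E) t) ⊤ ≤ past E s :=
    le_iSup (fun u : Set.Iic s => MeasurableSpace.comap (X (E := E) u.1) ⊤) ⟨t, h⟩
  exact this _ ⟨S, trivial, rfl⟩

lemma past_le (s : ℝ≥0) : past E s ≤ PathSpace.measurableSpace E :=
  iSup_le fun u => le_iSup (fun u : ℝ≥0 => MeasurableSpace.comap (X (E := E) u) ⊤) u.1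

lemma measurableSet_mem (t : ℝ≥0) (S : Set E) : MeasurableSet {ω | X t ω ∈ S} :=
  past_le t _ (measurableSet_past le_rfl S)

lemma measurableSet_eq (t : ℝ≥0) (y : E) : MeasurableSet {ω | X t ω = y} :=
  measurableSet_mem t {y}

lemma measurable_comp {β : Type*} [MeasurableSpace β] (g : E → β) (t : ℝ≥0) :
    Measurable fun ω => g (X t ω) :=
  fun S _ => measurableSet_mem t (g ⁻¹' S)

/-- A trajectory takes finitely many values on every bounded time interval. -/
lemma finite_range (ω : PathSpace E) (t : ℝ≥0) : {y | ∃ s ≤ t, X s ω = y}.Finite := by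
  have key : ((fun s => X s ω) '' Set.Icc 0 t).Finite := by
    refine IsCompact.induction_on (p := fun K => ((fun s => X s ω) '' K).Finite)
      isCompact_Icc (by simp) (fun s u hsu hu => hu.subset (Set.image_mono hsu))
      (fun s u hs hu => by rw [Set.image_union]; exact hs.union hu) ?_
    intro s _
    -- Near `s` the path takes at most two values, its left limit and its value at `s`; compactness
    -- makes this global.
    obtain ⟨a, ha⟩ := ω.2.2 s
    have hb := ω.2.1 s
    refine ⟨{u | X u ω = X s ω ∨ X u ω = a}, mem_nhdsWithin_of_mem_nhds ?_, ?_⟩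
    · rw [← nhdsLT_sup_nhdsGE, ← Set.Ioi_insert, nhdsWithin_insert]
      refine mem_sup.2 ⟨ha.mono fun u hu => Or.inr hu, mem_sup.2 ⟨?_, hb.mono fun u hu => Or.inl hu⟩⟩
      exact mem_pure.2 (Or.inl rfl)
    · refine (Set.toFinite {X s ω, a}).subset ?_
      rintro _ ⟨u, hu, rfl⟩
      exact hu
  refine key.subset ?_
  rintro y ⟨s, hs, rfl⟩
  exact ⟨s, ⟨zero_le, hs⟩, rfl⟩

end PathSpace

/-! ### Transition probabilities, their derivative at zero and their decay -/

open PathSpace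

/-- The transition probability `P_x[X_t = y]` as a real number. -/
noncomputable def transProb (P : E → Measure (PathSpace E)) (t : ℝ≥0) (x y : E) : ℝ :=
  (P x).real {ω | X t ω = y}

/-- The transition semigroup `v ↦ E_x[v(X_t)]`. -/
noncomputable def semigroup (P : E → Measure (PathSpace E)) (t : ℝ≥0) (v : E → ℝ) (x : E) : ℝ :=
  ∫ ω, v (X t ω) ∂(P x)

lemma support_finite_of_vanishingOff {A : Finset E} {v : E → ℝ} (hv : v ∈ vanishingOff A) :
    v.support.Finite :=
  A.finite_toSet.subset fun y hy => by
    by_contra h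
    exact hy (hv y h)

lemma generator_eq_sum (Q : JumpRates E) {A : Finset E} {v : E → ℝ} (hv : v ∈ vanishingOff A)
    (y : E) : generator Q.rate v y =
      (∑ z ∈ A, (Q.rate y z : ℝ) * v z) - (∑' z, (Q.rate y z : ℝ)) * v y := by
  have hs : Summable fun z => (Q.rate y z : ℝ) := NNReal.summable_coe.2 (Q.summable_rate y)
  have h1 : HasSum (fun z => (Q.rate y z : ℝ) * v z) (∑ z ∈ A, (Q.rate y z : ℝ) * v z) :=
    hasSum_sum_of_ne_finset_zero fun z hz => by rw [hv z hz, mul_zero]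
  have h2 := hs.hasSum.mul_right (v y)
  unfold generator
  rw [← (h1.sub h2).tsum_eq]
  exact tsum_congr fun z => by ring

section
variable {Q : JumpRates E} {P : E → Measure (PathSpace E)}

lemma transProb_nonneg (t : ℝ≥0) (x y : E) : 0 ≤ transProb P t x y := measureReal_nonneg

namespace IsMarkovProcess

lemma transProb_le_one (hP : IsMarkovProcess Q P) (t : ℝ≥0) (x y : E) : transProb P t x y ≤ 1 := by
  have := hP.isProbabilityMeasure x
  exact measureReal_le_one

lemma ofReal_transProb (hP : IsMarkovProcess Q P) (t : ℝ≥0) (x y : E) :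
    ENNReal.ofReal (transProb P t x y) = P x {ω | X t ω = y} := by
  have := hP.isProbabilityMeasure x
  exact ofReal_measureReal

lemma measure_inter (hP : IsMarkovProcess Q P) (x y z : E) (s t : ℝ≥0) {B : Set (PathSpace E)}
    (hB : MeasurableSet[past E s] B) (hz : B ⊆ {ω | X s ω = z}) :
    P x (B ∩ {ω | X (s + t) ω = y}) = P x B * P z {ω | X t ω = y} := by
  rw [hP.markov x s t y B hB, setLIntegral_congr_fun (g := fun _ => P z {ω | X t ω = y})
    (past_le s _ hB)]
  · rw [setLIntegral_const, mul_comm]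
  · intro ω hω
    have : X s ω = z := hz hω
    simp only [this]

lemma mul_transProb_le (hP : IsMarkovProcess Q P) (s t : ℝ≥0) (x z y : E) :
    transProb P s x z * transProb P t z y ≤ transProb P (s + t) x y := by
  have := hP.isProbabilityMeasure x
  unfold transProb Measure.real
  rw [← ENNReal.toReal_mul, ← hP.measure_inter x y z s t (B := {ω | X s ω = z})
    (measurableSet_past le_rfl {z}) (fun _ h => h)]
  exact ENNReal.toReal_mono (measure_ne_top _ _) (measure_mono Set.inter_subset_right)

lemma integrable_comp (hP : IsMarkovProcess Q P) (t : ℝ≥0) (x : E) (g : E → ℝ) {C : ℝ}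
    (hg : ∀ y, |g y| ≤ C) : Integrable (fun ω => g (X t ω)) (P x) := by
  have := hP.isProbabilityMeasure x
  exact Integrable.of_bound (measurable_comp g t).aestronglyMeasurable C
    (ae_of_all _ fun ω => hg _)

lemma semigroup_eq_sum (hP : IsMarkovProcess Q P) {A : Finset E} {v : E → ℝ}
    (hv : v ∈ vanishingOff A) (t : ℝ≥0) (x : E) :
    semigroup P t v x = ∑ z ∈ A, v z * transProb P t x z := by
  classical
  have := hP.isProbabilityMeasure x
  have h : ∀ ω, v (X t ω) = ∑ z ∈ A, v z * Set.indicator {ω | X t ω = z} 1 ω := by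
    intro ω
    simp only [Set.indicator_apply, Set.mem_ofPred_eq, Pi.one_apply, mul_ite, mul_one, mul_zero,
      Finset.sum_ite_eq]
    split_ifs with h
    · rfl
    · exact hv _ h
  unfold semigroup
  simp_rw [h]
  rw [integral_finsetSum]
  · refine Finset.sum_congr rfl fun z _ => ?_
    rw [integral_const_mul, integral_indicator_one (measurableSet_eq t z)]
    rfl
  · intro z _
    exact (((integrable_const (1 : ℝ)).indicator (measurableSet_eq t z))).const_mul _

lemma semigroup_add (hP : IsMarkovProcess Q P) {A : Finset E} {v : E → ℝ}
    (hv : v ∈ vanishingOff A) (s t : ℝ≥0) (x : E) :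
    semigroup P (s + t) v x = ∫ ω, semigroup P t v (X s ω) ∂(P x) := by
  simp_rw [hP.semigroup_eq_sum hv]
  have hb : ∀ z y, |transProb P t y z| ≤ 1 := fun z y => by
    rw [abs_of_nonneg (transProb_nonneg _ _ _)]
    exact hP.transProb_le_one _ _ _
  rw [integral_finsetSum _ fun z _ =>
    (hP.integrable_comp s x (fun y => transProb P t y z) (hb z)).const_mul _]
  refine Finset.sum_congr rfl fun z _ => ?_
  rw [integral_const_mul]
  congr 1
  have := hP.markov x s t z Set.univ MeasurableSet.univ
  rw [Set.univ_inter, Measure.restrict_univ] at this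
  unfold transProb Measure.real
  rw [this, integral_toReal (measurable_comp (fun y => P y {ω | X t ω = z}) s).aemeasurable]
  refine ae_of_all _ fun ω => ?_
  have := hP.isProbabilityMeasure (X s ω)
  exact measure_lt_top _ _

lemma tendsto_semigroup (hP : IsMarkovProcess Q P) {A : Finset E} {v : E → ℝ}
    (hv : v ∈ vanishingOff A) (x : E) :
    Tendsto (fun t : ℝ≥0 => (semigroup P t v x - v x) / t) (𝓝[>] 0)
      (𝓝 (generator Q.rate v x)) :=
  hP.hasGenerator v (support_finite_of_vanishingOff hv) x

open Classical in
lemma tendsto_transProb (hP : IsMarkovProcess Q P) (x y : E) :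
    Tendsto (fun t : ℝ≥0 => (transProb P t x y - if x = y then 1 else 0) / t) (𝓝[>] 0)
      (𝓝 ((Q.rate x y : ℝ) - if x = y then ∑' z, (Q.rate x z : ℝ) else 0)) := by
  have hv : (fun z => if z = y then (1 : ℝ) else 0) ∈ vanishingOff {y} := by
    intro z hz
    simp only [Finset.mem_singleton] at hz
    simp [hz]
  have := hP.tendsto_semigroup hv x
  rw [generator_eq_sum Q hv] at this
  simp_rw [hP.semigroup_eq_sum hv] at this
  simpa using this

lemma tendsto_transProb_self (hP : IsMarkovProcess Q P) (x : E) :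
    Tendsto (fun t : ℝ≥0 => (transProb P t x x - 1) / t) (𝓝[>] 0)
      (𝓝 (-∑' z, (Q.rate x z : ℝ))) := by
  simpa [Q.rate_self] using hP.tendsto_transProb x x

lemma tendsto_transProb_of_ne (hP : IsMarkovProcess Q P) {x y : E} (h : x ≠ y) :
    Tendsto (fun t : ℝ≥0 => transProb P t x y / t) (𝓝[>] 0) (𝓝 (Q.rate x y : ℝ)) := by
  simpa [h] using hP.tendsto_transProb x y

/-- The derivative at zero is `-λ(x)`; the slack in `C = λ(x) + 1` turns the limit into an
inequality valid for all small times. -/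
lemma exists_le_transProb_self (hP : IsMarkovProcess Q P) (x : E) :
    ∃ C > 0, ∃ h₀ : ℝ≥0, 0 < h₀ ∧ ∀ h : ℝ≥0, h < h₀ → 1 - C * h ≤ transProb P h x x := by
  set c := ∑' z, (Q.rate x z : ℝ)
  have hc : 0 ≤ c := tsum_nonneg fun _ => NNReal.coe_nonneg _
  have h1 := (hP.tendsto_transProb_self x).eventually_const_le (show -(c + 1) < -c by linarith)
  obtain ⟨h₀, hpos, hh⟩ := mem_nhdsGT_iff_exists_Ioo_subset.1 h1
  refine ⟨c + 1, by linarith, h₀, hpos, fun h hh0 => ?_⟩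
  rcases eq_or_lt_of_le (zero_le (a := h)) with rfl | h0
  · have : transProb P 0 x x = 1 := by
      have := hP.isProbabilityMeasure x
      unfold transProb
      rw [measureReal_def, (prob_compl_eq_zero_iff (measurableSet_eq 0 x)).1 (hP.start x)]
      simp
    simp [this]
  · have h2 : -(c + 1) ≤ (transProb P h x x - 1) / h := hh ⟨h0, hh0⟩
    rw [le_div_iff₀ (by exact_mod_cast h0)] at h2
    linarith

/-- Follow a chain of jumps of positive rate: each has positive probability in a short time, and
these probabilities multiply. -/
lemma exists_transProb_pos (hP : IsMarkovProcess Q P) (hQ : Q.Irreducible) (x y : E) :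
    ∃ t, 0 < transProb P t x y := by
  induction hQ x y with
  | refl =>
    obtain ⟨C, hC, h₀, hpos, hh⟩ := hP.exists_le_transProb_self x
    have := hh 0 hpos
    simp only [NNReal.coe_zero, mul_zero, sub_zero] at this
    exact ⟨0, by linarith⟩
  | @tail y z _ hyz ih =>
    obtain ⟨s, hs⟩ := ih
    have hne : y ≠ z := by
      rintro rfl
      simp [Q.rate_self] at hyz
    have h1 := (hP.tendsto_transProb_of_ne hne).eventually_const_lt
      (show (0 : ℝ) < Q.rate y z by exact_mod_cast hyz)
    obtain ⟨t, ht, ht0⟩ := (h1.and self_mem_nhdsWithin).exists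
    have ht0 : (0 : ℝ) < t := by exact_mod_cast ht0
    have : 0 < transProb P t y z := by
      have := mul_pos ht ht0
      rwa [div_mul_cancel₀ _ ht0.ne'] at this
    exact ⟨s + t, (mul_pos hs this).trans_le (hP.mul_transProb_le s t x y z)⟩

/-- For a transient irreducible process, `P_x[X_t = y]` tends to zero. -/
lemma tendsto_transProb_atTop (hP : IsMarkovProcess Q P) (hQ : Q.Irreducible)
    (ht : IsTransient P) (x y : E) : Tendsto (fun t => transProb P t x y) atTop (𝓝 0) := by
  have hself : Tendsto (fun t => transProb P t x x) atTop (𝓝 0) := by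
    have := hP.isProbabilityMeasure x
    have h : ∀ t, transProb P t x x = ∫ ω, Set.indicator {ω | X t ω = x} 1 ω ∂(P x) := fun t =>
      (integral_indicator_one (measurableSet_eq t x)).symm
    simp_rw [h]
    rw [← integral_zero (PathSpace E) ℝ (μ := P x)]
    refine tendsto_integral_filter_of_dominated_convergence (fun _ => 1) ?_ ?_
      (integrable_const _) ?_
    · exact Eventually.of_forall fun t =>
        (measurable_one.indicator (measurableSet_eq t x)).aestronglyMeasurable
    · refine Eventually.of_forall fun t => ae_of_all _ fun ω => ?_
      by_cases h : X t ω = x <;> simp [h]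
    · filter_upwards [ht x] with ω ⟨T, hT⟩
      refine tendsto_const_nhds.congr' ?_
      filter_upwards [eventually_gt_atTop T] with t htT
      rw [Set.indicator_of_notMem]
      exact fun h => (hT h).not_gt htT
  -- Returning from `y` to `x` gives `p_t(x,y) p_s(y,x) ≤ p_{t+s}(x,x)`, which reduces the claim to
  -- the diagonal.
  obtain ⟨s, hs⟩ := hP.exists_transProb_pos hQ y x
  have h2 : Tendsto (fun t => transProb P (t + s) x x / transProb P s y x) atTop (𝓝 0) := by
    have := (hself.comp (tendsto_atTop_mono (fun t => le_self_add (b := s))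
      tendsto_id)).div_const (transProb P s y x)
    simpa using this
  refine squeeze_zero (fun t => transProb_nonneg _ _ _) (fun t => ?_) h2
  rw [le_div_iff₀ hs]
  exact hP.mul_transProb_le t s x y x

lemma tendsto_semigroup_atTop (hP : IsMarkovProcess Q P) (hQ : Q.Irreducible)
    (ht : IsTransient P) {A : Finset E} {v : E → ℝ} (hv : v ∈ vanishingOff A) (x : E) :
    Tendsto (fun t => semigroup P t v x) atTop (𝓝 0) := by
  simp_rw [hP.semigroup_eq_sum hv]
  have := tendsto_finsetSum A fun z _ =>
    (hP.tendsto_transProb_atTop hQ ht x z).const_mul (v z)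
  simpa using this

end IsMarkovProcess
end

/-! ### From stationarity to invariance for the jump rates -/

section
variable {Q : JumpRates E} {P : E → Measure (PathSpace E)} {μ : E → ℝ≥0}

/-- The (possibly infinite) law on path space of the process started from `μ`. -/
noncomputable def initialLaw (P : E → Measure (PathSpace E)) (μ : E → ℝ≥0) :
    Measure (PathSpace E) :=
  Measure.sum fun i => μ i • P i

lemma initialLaw_apply {B : Set (PathSpace E)} (hB : MeasurableSet B) :
    initialLaw P μ B = ∑' i, (μ i : ℝ≥0∞) * P i B := by
  rw [initialLaw, Measure.sum_apply _ hB]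
  rfl

lemma IsStationary.initialLaw_eq (hμ : IsStationary P μ) (t : ℝ≥0) (y : E) :
    initialLaw P μ {ω | X t ω = y} = μ y := by
  rw [initialLaw_apply (measurableSet_eq t y), hμ.invariant]

lemma IsMarkovProcess.initialLaw_inter (hP : IsMarkovProcess Q P) (y z : E) (s t : ℝ≥0)
    {B : Set (PathSpace E)} (hB : MeasurableSet[past E s] B) (hz : B ⊆ {ω | X s ω = z}) :
    initialLaw P μ (B ∩ {ω | X (s + t) ω = y}) = initialLaw P μ B * P z {ω | X t ω = y} := by
  rw [initialLaw_apply (past_le s _ hB),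
    initialLaw_apply ((past_le s _ hB).inter (measurableSet_eq _ _)), ← ENNReal.tsum_mul_right]
  exact tsum_congr fun i => by rw [hP.measure_inter i y z s t hB hz, mul_assoc]

lemma IsStationary.pos (hμ : IsStationary P μ) (hP : IsMarkovProcess Q P) (hQ : Q.Irreducible)
    (y : E) : 0 < μ y := by
  obtain ⟨x, hx⟩ := Function.ne_iff.1 hμ.ne_zero
  obtain ⟨t, ht⟩ := hP.exists_transProb_pos hQ x y
  by_contra h
  have h0 := hμ.invariant t y
  rw [nonpos_iff_eq_zero.1 (not_lt.1 h), ENNReal.coe_zero, ENNReal.tsum_eq_zero] at h0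
  have h1 := h0 x
  rw [← hP.ofReal_transProb] at h1
  simp only [mul_eq_zero, ENNReal.coe_eq_zero, ENNReal.ofReal_eq_zero] at h1
  rcases h1 with h1 | h1
  · exact hx h1
  · exact h1.not_gt ht

/-- The flow in time `h` from the complement of `F` into `j ∈ F`, under the stationary state. -/
noncomputable def inflow (P : E → Measure (PathSpace E)) (μ : E → ℝ≥0) (F : Finset E) (j : E)
    (h : ℝ≥0) : ℝ :=
  μ j - ∑ l ∈ F, μ l * transProb P h l j

/-- The mass at `j` at time `s + h` is `μ j`, by stationarity; subtract the part that was in `F` at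
time `s`. Both are finite even when `μ` has infinite mass. -/
lemma IsMarkovProcess.initialLaw_exit (hP : IsMarkovProcess Q P) (hμ : IsStationary P μ)
    (F : Finset E) (j : E) (s h : ℝ≥0) :
    initialLaw P μ ({ω | X s ω ∉ F} ∩ {ω | X (s + h) ω = j}) =
      ENNReal.ofReal (inflow P μ F j h) := by
  classical
  have h1 : initialLaw P μ ({ω | X s ω ∈ F} ∩ {ω | X (s + h) ω = j}) =
      ENNReal.ofReal (∑ l ∈ F, μ l * transProb P h l j) := by
    have : {ω | X s ω ∈ F} ∩ {ω | X (s + h) ω = j} =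
        ⋃ l ∈ F, ({ω | X s ω = l} ∩ {ω | X (s + h) ω = j}) := by
      ext ω
      simp
    rw [this, measure_biUnion_finset, ENNReal.ofReal_sum_of_nonneg]
    · refine Finset.sum_congr rfl fun l _ => ?_
      rw [hP.initialLaw_inter (B := {ω | X s ω = l}) j l s h (measurableSet_past le_rfl {l})
        (fun _ h => h), hμ.initialLaw_eq, ENNReal.ofReal_mul (NNReal.coe_nonneg _),
        hP.ofReal_transProb, ENNReal.ofReal_coe_nnreal]
    · exact fun l _ => mul_nonneg (NNReal.coe_nonneg _) (transProb_nonneg _ _ _)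
    · intro l _ l' _ hne
      refine Set.disjoint_left.2 fun ω h h' => hne ?_
      exact (show X s ω = l from h.1).symm.trans h'.1
    · exact fun l _ => (measurableSet_eq _ _).inter (measurableSet_eq _ _)
  have h2 := measure_inter_add_sdiff (μ := initialLaw P μ) {ω | X (s + h) ω = j}
    (measurableSet_mem s (F : Set E))
  have h3 : {ω | X (s + h) ω = j} \ {ω | X s ω ∈ (F : Set E)} =
      {ω | X s ω ∉ F} ∩ {ω | X (s + h) ω = j} := by
    ext ω
    simp [and_comm]
  have h4 : {ω | X (s + h) ω = j} ∩ {ω | X s ω ∈ (F : Set E)} =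
      {ω | X s ω ∈ F} ∩ {ω | X (s + h) ω = j} := Set.inter_comm _ _
  rw [h3, h4, h1, hμ.initialLaw_eq] at h2
  rw [inflow, ENNReal.ofReal_sub, ENNReal.ofReal_coe_nnreal, ← h2, ENNReal.add_sub_cancel_left]
  · exact ENNReal.ofReal_ne_top
  · exact Finset.sum_nonneg fun l _ => mul_nonneg (NNReal.coe_nonneg _) (transProb_nonneg _ _ _)

lemma IsMarkovProcess.inflow_nonneg (hP : IsMarkovProcess Q P) (hμ : IsStationary P μ)
    (F : Finset E) (j : E) (h : ℝ≥0) : 0 ≤ inflow P μ F j h := by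
  classical
  have h1 := hμ.invariant h j
  have h2 := ENNReal.sum_le_tsum (f := fun l => (μ l : ℝ≥0∞) * P l {ω | X h ω = j}) F
  rw [h1] at h2
  have h3 : ENNReal.ofReal (∑ l ∈ F, μ l * transProb P h l j) ≤ μ j := by
    rw [ENNReal.ofReal_sum_of_nonneg
      fun l _ => mul_nonneg (NNReal.coe_nonneg _) (transProb_nonneg _ _ _)]
    refine le_trans (le_of_eq (Finset.sum_congr rfl fun l _ => ?_)) h2
    rw [ENNReal.ofReal_mul (NNReal.coe_nonneg _), hP.ofReal_transProb, ENNReal.ofReal_coe_nnreal]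
  rw [inflow, sub_nonneg]
  rwa [← ENNReal.ofReal_coe_nnreal, ENNReal.ofReal_le_ofReal_iff (NNReal.coe_nonneg _)] at h3

/-- The trajectories outside `F` at time `k h` which are at `j` at the `r + 1` following multiples
of `h`. -/
def lastEntrance (F : Finset E) (j : E) (h : ℝ≥0) (k : ℕ) : ℕ → Set (PathSpace E)
  | 0 => {ω | X (k * h) ω ∉ F} ∩ {ω | X (k * h + h) ω = j}
  | r + 1 => lastEntrance F j h k r ∩ {ω | X (k * h + h + r * h + h) ω = j}

lemma mem_lastEntrance {F : Finset E} {j : E} {h : ℝ≥0} {k r : ℕ} {ω : PathSpace E} :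
    ω ∈ lastEntrance F j h k r ↔
      X (k * h) ω ∉ F ∧ ∀ i ≤ r, X (((k + 1 + i : ℕ) : ℝ≥0) * h) ω = j := by
  induction r with
  | zero =>
    have : ((k + 1 + 0 : ℕ) : ℝ≥0) * h = k * h + h := by push_cast; ring
    simp [lastEntrance, ← this]
  | succ r ih =>
    have : ((k + 1 + (r + 1) : ℕ) : ℝ≥0) * h = k * h + h + r * h + h := by push_cast; ring
    rw [lastEntrance, Set.mem_inter_iff, ih, Set.mem_ofPred_eq, ← this]
    constructor
    · rintro ⟨⟨h1, h2⟩, h3⟩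
      refine ⟨h1, fun i hi => ?_⟩
      rcases Nat.le_succ_iff.1 hi with hi | rfl
      · exact h2 i hi
      · exact h3
    · rintro ⟨h1, h2⟩
      exact ⟨⟨h1, fun i hi => h2 i (by omega)⟩, h2 _ le_rfl⟩

lemma measurableSet_lastEntrance (F : Finset E) (j : E) (h : ℝ≥0) (k r : ℕ) :
    MeasurableSet[past E (k * h + h + r * h)] (lastEntrance F j h k r) := by
  induction r with
  | zero =>
    refine MeasurableSet.inter ?_ ?_
    · exact measurableSet_past (by rw [add_assoc]; exact le_self_add) (F : Set E)ᶜ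
    · exact measurableSet_past le_self_add {j}
  | succ r ih =>
    have e : (k * h + h + (r + 1 : ℕ) * h : ℝ≥0) = k * h + h + r * h + h := by push_cast; ring
    rw [e]
    refine MeasurableSet.inter ?_ (measurableSet_past le_rfl {j})
    have hle : past E (k * h + h + r * h) ≤ past E (k * h + h + r * h + h) :=
      iSup_le fun u => le_iSup (fun u : Set.Iic (k * h + h + r * h + h) =>
        MeasurableSpace.comap (X (E := E) u.1) ⊤) ⟨u.1, Set.mem_Iic.2 (le_trans u.2 le_self_add)⟩
    exact hle _ ih

lemma IsMarkovProcess.initialLaw_lastEntrance (hP : IsMarkovProcess Q P) (hμ : IsStationary P μ)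
    (F : Finset E) (j : E) (h : ℝ≥0) (k r : ℕ) :
    initialLaw P μ (lastEntrance F j h k r) =
      ENNReal.ofReal (inflow P μ F j h * transProb P h j j ^ r) := by
  induction r with
  | zero => rw [lastEntrance, hP.initialLaw_exit hμ, pow_zero, mul_one]
  | succ r ih =>
    rw [lastEntrance, hP.initialLaw_inter j j _ _ (measurableSet_lastEntrance F j h k r) ?_, ih, pow_succ, ← mul_assoc, ENNReal.ofReal_mul
        (mul_nonneg (hP.inflow_nonneg hμ F j h) (pow_nonneg (transProb_nonneg _ _ _) _)),
      hP.ofReal_transProb]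
    intro ω hω
    have := (mem_lastEntrance.1 hω).2 r le_rfl
    have e : ((k + 1 + r : ℕ) : ℝ≥0) * h = k * h + h + r * h := by push_cast; ring
    rwa [e] at this

/-- The trajectories at `j` at time `t` which are outside `F` at some dyadic fraction of `t`. -/
def dyadicExit (F : Finset E) (j : E) (t : ℝ≥0) : Set (PathSpace E) :=
  {ω | X t ω = j ∧ ∃ m k : ℕ, k < 2 ^ m ∧ X (k * (t / 2 ^ m)) ω ∉ F}

lemma measurableSet_dyadicExit (F : Finset E) (j : E) (t : ℝ≥0) :
    MeasurableSet (dyadicExit F j t) := by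
  have : dyadicExit F j t = {ω | X t ω = j} ∩
      ⋃ (m : ℕ) (k : ℕ) (_ : k < 2 ^ m), {ω | X (k * (t / 2 ^ m)) ω ∈ (F : Set E)ᶜ} := by
    ext ω
    simp [dyadicExit]
  rw [this]
  exact (measurableSet_eq t j).inter (MeasurableSet.iUnion fun m => MeasurableSet.iUnion fun k =>
    MeasurableSet.iUnion fun _ => measurableSet_mem _ _)

/-- Continuity from above: the events lie in `{X_t = j}`, of finite mass, and no path leaves every
`A N` before `t`, as it visits finitely many states. -/
lemma IsStationary.tendsto_dyadicExit (hμ : IsStationary P μ) {A : ℕ → Finset E} (hA : Monotone A)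
    (hcover : ∀ y, ∃ n, y ∈ A n) (j : E) (t : ℝ≥0) :
    Tendsto (fun N => initialLaw P μ (dyadicExit (A N) j t)) atTop (𝓝 0) := by
  have hempty : ⋂ N, dyadicExit (A N) j t = ∅ := by
    refine Set.eq_empty_of_forall_notMem fun ω hω => ?_
    choose n hn using hcover
    obtain ⟨N, hN⟩ := ((ω.finite_range t).image n).bddAbove
    obtain ⟨-, m, k, hk, hout⟩ := Set.mem_iInter.1 hω N
    refine hout (hA (hN ⟨_, ⟨_, ?_, rfl⟩, rfl⟩) (hn _))
    calc (k : ℝ≥0) * (t / 2 ^ m) ≤ 2 ^ m * (t / 2 ^ m) := by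
          gcongr
          exact_mod_cast hk.le
      _ = t := mul_div_cancel₀ _ (by positivity)
  rw [← measure_empty (μ := initialLaw P μ), ← hempty]
  refine tendsto_measure_iInter_atTop
    (fun N => (measurableSet_dyadicExit _ _ _).nullMeasurableSet) ?_ ⟨0, ?_⟩
  · rintro N N' h ω ⟨h1, m, k, hk, h2⟩
    exact ⟨h1, m, k, hk, fun h3 => h2 (hA h h3)⟩
  · refine ne_top_of_le_ne_top ?_ (measure_mono (t := {ω | X t ω = j}) fun ω h => h.1)
    rw [hμ.initialLaw_eq]
    exact ENNReal.coe_ne_top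

/-- The events "outside `F` at grid time `k`, then at `j` at every later grid time up to `t`" are
disjoint for distinct `k`. The exponent counts the steps from grid time `k + 1` to `2 ^ m`. -/
lemma IsMarkovProcess.sum_inflow_le (hP : IsMarkovProcess Q P) (hμ : IsStationary P μ)
    {F : Finset E} {j : E} (hj : j ∈ F) (t : ℝ≥0) (m : ℕ) :
    ∑ k ∈ Finset.range (2 ^ m), ENNReal.ofReal
        (inflow P μ F j (t / 2 ^ m) * transProb P (t / 2 ^ m) j j ^ (2 ^ m - 1 - k)) ≤
      initialLaw P μ (dyadicExit F j t) := by
  simp_rw [← fun k => hP.initialLaw_lastEntrance hμ F j (t / 2 ^ m) k (2 ^ m - 1 - k)]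
  rw [← measure_biUnion_finset]
  · refine measure_mono fun ω hω => ?_
    simp only [Set.mem_iUnion, Finset.mem_range, exists_prop] at hω
    obtain ⟨k, hk, hω⟩ := hω
    obtain ⟨h1, h2⟩ := mem_lastEntrance.1 hω
    refine ⟨?_, m, k, hk, h1⟩
    have := h2 _ le_rfl
    rw [show k + 1 + (2 ^ m - 1 - k) = 2 ^ m by omega] at this
    rwa [Nat.cast_pow, Nat.cast_ofNat, mul_div_cancel₀ _ (by positivity)] at this
  · have key : ∀ k ∈ Finset.range (2 ^ m), ∀ k' ∈ Finset.range (2 ^ m), k < k' →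
        Disjoint (lastEntrance F j (t / 2 ^ m) k (2 ^ m - 1 - k))
          (lastEntrance F j (t / 2 ^ m) k' (2 ^ m - 1 - k')) := by
      intro k hk k' hk' hlt
      rw [Finset.mem_range] at hk hk'
      refine Set.disjoint_left.2 fun ω h h' => (mem_lastEntrance.1 h').1 ?_
      have := (mem_lastEntrance.1 h).2 (k' - (k + 1)) (by omega)
      rw [show k + 1 + (k' - (k + 1)) = k' by omega] at this
      rwa [this]
    intro k hk k' hk' hne
    rcases lt_or_gt_of_ne hne with h | h
    · exact key k hk k' hk' h
    · exact (key k' hk' k hk h).symm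
  · exact fun k _ => past_le _ _ (measurableSet_lastEntrance _ _ _ _ _)

lemma IsMarkovProcess.tendsto_inflow (hP : IsMarkovProcess Q P) (μ : E → ℝ≥0)
    {F : Finset E} {j : E} (hj : j ∈ F) :
    Tendsto (fun h : ℝ≥0 => inflow P μ F j h / h) (𝓝[>] 0)
      (𝓝 (μ j * (∑' z, (Q.rate j z : ℝ)) - ∑ l ∈ F, (μ l * Q.rate l j : ℝ))) := by
  classical
  have h1 := tendsto_finsetSum F fun l _ => (hP.tendsto_transProb l j).const_mul (μ l : ℝ)
  have h2 := h1.neg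
  convert h2 using 1
  · ext h
    rw [inflow, ← Finset.sum_neg_distrib]
    simp only [sub_div, mul_sub, mul_div_assoc', neg_sub, Finset.sum_sub_distrib, mul_ite, mul_one,
      mul_zero, ite_div, zero_div, Finset.sum_ite_eq', hj, if_true, Finset.sum_div]
  · rw [← Finset.sum_neg_distrib]
    simp only [mul_sub, neg_sub, Finset.sum_sub_distrib, mul_ite, mul_zero, Finset.sum_ite_eq', hj,
      if_true]

/-- A stationary state is an invariant measure for the jump rates. -/
theorem IsStationary.hasSum_rate (hμ : IsStationary P μ) (hP : IsMarkovProcess Q P)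
    {A : ℕ → Finset E} (hA : Monotone A) (hcover : ∀ y, ∃ n, y ∈ A n) (j : E) :
    HasSum (fun l => (μ l * Q.rate l j : ℝ)) (μ j * ∑' z, (Q.rate j z : ℝ)) := by
  classical
  obtain ⟨C, hC, h₀, hh₀, hself⟩ := hP.exists_le_transProb_self j
  -- With `C t ≤ 1/2`, Bernoulli's inequality keeps the probability of being at `j` at all remaining
  -- grid times above `1/2`, uniformly in the mesh.
  obtain ⟨t, ht0, hth, htC⟩ : ∃ t : ℝ≥0, 0 < t ∧ t < h₀ ∧ C * t ≤ 1 / 2 := by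
    have h1 : ∀ᶠ t : ℝ≥0 in 𝓝[>] 0, t < h₀ :=
      mem_nhdsWithin_of_mem_nhds (Iio_mem_nhds hh₀)
    have h2 : ∀ᶠ t : ℝ≥0 in 𝓝[>] 0, C * t ≤ 1 / 2 := by
      refine mem_nhdsWithin_of_mem_nhds ?_
      have : Tendsto (fun t : ℝ≥0 => C * (t : ℝ)) (𝓝 0) (𝓝 (C * (0 : ℝ≥0))) := by
        exact (NNReal.continuous_coe.tendsto 0).const_mul C
      exact this.eventually_le_const (by simp)
    obtain ⟨t, ⟨h1, h2⟩, h3⟩ := ((h1.and h2).and self_mem_nhdsWithin).exists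
    exact ⟨t, h3, h1, h2⟩
  have hstep : Tendsto (fun m : ℕ => t / 2 ^ m) atTop (𝓝[>] 0) := by
    refine tendsto_nhdsWithin_iff.2 ⟨?_, Eventually.of_forall fun m => ?_⟩
    · have := (NNReal.tendsto_pow_atTop_nhds_zero_of_lt_one (r := 2⁻¹) (by
        rw [← NNReal.coe_lt_coe]; push_cast; norm_num)).const_mul t
      simpa [div_eq_mul_inv] using this
    · have : 0 < t / 2 ^ m := by positivity
      exact this
  have hfin : ∀ F : Finset E, initialLaw P μ (dyadicExit F j t) ≠ ∞ := fun F => by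
    refine ne_top_of_le_ne_top ?_ (measure_mono (t := {ω | X t ω = j}) fun ω h => h.1)
    rw [hμ.initialLaw_eq]
    exact ENNReal.coe_ne_top
  -- Each of the `2 ^ m` terms is at least half the inflow, so the inflow per unit time is bounded
  -- independently of `m`.
  have hbound : ∀ F : Finset E, j ∈ F → ∀ m : ℕ, inflow P μ F j (t / 2 ^ m) / (t / 2 ^ m : ℝ≥0) ≤
      2 / t * (initialLaw P μ (dyadicExit F j t)).toReal := by
    intro F hj m
    have h1 := hP.sum_inflow_le hμ hj t m
    have hin := hP.inflow_nonneg hμ F j (t / 2 ^ m)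
    rw [← ENNReal.ofReal_sum_of_nonneg fun k _ =>
      mul_nonneg hin (pow_nonneg (transProb_nonneg _ _ _) _),
      ENNReal.ofReal_le_iff_le_toReal (hfin F)] at h1
    have hle : t / 2 ^ m ≤ t := div_le_self zero_le (one_le_pow₀ (by norm_num))
    have hp := hself _ (hle.trans_lt hth)
    have hpow : ∀ k ∈ Finset.range (2 ^ m), inflow P μ F j (t / 2 ^ m) * (1 / 2) ≤
        inflow P μ F j (t / 2 ^ m) * transProb P (t / 2 ^ m) j j ^ (2 ^ m - 1 - k) := by
      intro k _
      refine mul_le_mul_of_nonneg_left ?_ hin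
      have hnn := transProb_nonneg (P := P) (t / 2 ^ m) j j
      have hb := one_add_mul_le_pow (a := transProb P (t / 2 ^ m) j j - 1) (by linarith)
        (2 ^ m)
      have hmono : transProb P (t / 2 ^ m) j j ^ (2 ^ m) ≤
          transProb P (t / 2 ^ m) j j ^ (2 ^ m - 1 - k) :=
        pow_le_pow_of_le_one hnn (hP.transProb_le_one _ _ _) ((Nat.sub_le _ _).trans (Nat.sub_le _ _))
      rw [add_sub_cancel] at hb
      refine le_trans ?_ (hb.trans hmono)
      have h4 : ((2 ^ m : ℕ) : ℝ) * (C * (t / 2 ^ m : ℝ≥0)) = C * t := by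
        push_cast
        field_simp
      have h5 : ((2 ^ m : ℕ) : ℝ) * (1 - C * (t / 2 ^ m : ℝ≥0)) ≤
          ((2 ^ m : ℕ) : ℝ) * transProb P (t / 2 ^ m) j j :=
        mul_le_mul_of_nonneg_left hp (by positivity)
      nlinarith
    have h6 := (Finset.sum_le_sum hpow).trans h1
    rw [Finset.sum_const, Finset.card_range, nsmul_eq_mul] at h6
    have htpos : (0 : ℝ) < t := by exact_mod_cast ht0
    push_cast at h6 ⊢
    rw [div_mul_eq_mul_div, le_div_iff₀ htpos, div_div_eq_mul_div, div_mul_cancel₀ _ htpos.ne']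
    linarith
  have hlim := fun (F : Finset E) (hj : j ∈ F) => (hP.tendsto_inflow μ hj).comp hstep
  have hle : ∀ F : Finset E, ∑ l ∈ F, (μ l * Q.rate l j : ℝ) ≤ μ j * ∑' z, (Q.rate j z : ℝ) := by
    intro F
    have h1 := ge_of_tendsto' (hlim (insert j F) (Finset.mem_insert_self _ _)) (b := 0)
      fun m => div_nonneg (hP.inflow_nonneg hμ _ _ _) (NNReal.coe_nonneg _)
    refine le_trans (Finset.sum_le_sum_of_subset_of_nonneg (Finset.subset_insert j F)
      fun l _ _ => by positivity) (sub_nonneg.1 h1)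
  have hsum : Summable fun l => (μ l * Q.rate l j : ℝ) :=
    summable_of_sum_le (fun l => by positivity) hle
  have hAtop : Tendsto A atTop atTop := tendsto_atTop_finset_of_monotone hA hcover
  have h1 := hsum.hasSum.comp hAtop
  have h2 : Tendsto (fun N => ∑ l ∈ A N, (μ l * Q.rate l j : ℝ)) atTop
      (𝓝 (μ j * ∑' z, (Q.rate j z : ℝ))) := by
    -- The missing part of the partial sum is the limiting inflow rate, which is squeezed to zero by
    -- the exit mass.
    have hε : Tendsto (fun N => μ j * (∑' z, (Q.rate j z : ℝ)) -
        2 / t * (initialLaw P μ (dyadicExit (A N) j t)).toReal) atTop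
        (𝓝 (μ j * ∑' z, (Q.rate j z : ℝ))) := by
      have := (ENNReal.tendsto_toReal ENNReal.zero_ne_top).comp
        (hμ.tendsto_dyadicExit hA hcover j t)
      simpa using (this.const_mul (2 / (t : ℝ))).const_sub (μ j * (∑' z, (Q.rate j z : ℝ)))
    refine tendsto_of_tendsto_of_tendsto_of_le_of_le' hε tendsto_const_nhds ?_
      (Eventually.of_forall fun N => hle _)
    obtain ⟨n, hn⟩ := hcover j
    filter_upwards [eventually_ge_atTop n] with N hN
    have := le_of_tendsto' (hlim (A N) (hA hN hn)) (hbound (A N) (hA hN hn))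
    linarith
  rw [← tendsto_nhds_unique h1 h2]
  exact hsum.hasSum

end

/-! ### Joint measurability in time and path -/

namespace PathSpace

/-- Right-continuity makes the coordinate process jointly measurable. -/
lemma measurableSet_prod_eq (x : E) :
    MeasurableSet {p : ℝ × PathSpace E | X p.1.toNNReal p.2 = x} := by
  -- The next point of the grid of mesh `1 / (m + 1)`. The `+ 1` after the floor keeps it strictly
  -- to the right of `t`, where right-continuity applies.
  set q : ℕ → ℝ → ℝ≥0 := fun m t => (⌊t.toNNReal * (m + 1)⌋₊ + 1) / (m + 1)
  have hq : ∀ t, Tendsto (fun m => q m t) atTop (𝓝[>] t.toNNReal) := by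
    intro t
    have hlt : ∀ m, t.toNNReal < q m t := fun m => by
      have hm : (0 : ℝ≥0) < m + 1 := by positivity
      exact (lt_div_iff₀ hm).2 (Nat.lt_floor_add_one _)
    refine tendsto_nhdsWithin_iff.2 ⟨?_, Eventually.of_forall hlt⟩
    have hle : ∀ m, q m t ≤ t.toNNReal + 1 / (m + 1) := fun m => by
      have hm : (0 : ℝ≥0) < m + 1 := by positivity
      rw [div_le_iff₀ hm, add_mul, div_mul_cancel₀ _ hm.ne']
      gcongr
      exact Nat.floor_le zero_le
    refine tendsto_of_tendsto_of_tendsto_of_le_of_le tendsto_const_nhds ?_ (fun m => (hlt m).le) hle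
    have : Tendsto (fun m : ℕ => 1 / ((m : ℝ≥0) + 1)) atTop (𝓝 0) :=
      tendsto_one_div_add_atTop_nhds_zero_nat
    simpa using this.const_add t.toNNReal
  have hS : ∀ m, MeasurableSet {p : ℝ × PathSpace E | X (q m p.1) p.2 = x} := by
    intro m
    have : {p : ℝ × PathSpace E | X (q m p.1) p.2 = x} =
        ⋃ k : ℕ, {t : ℝ | ⌊t.toNNReal * (m + 1)⌋₊ = k} ×ˢ
          {ω | X (((k : ℝ≥0) + 1) / (m + 1)) ω = x} := by
      ext ⟨t, ω⟩
      simp [q]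
    rw [this]
    refine MeasurableSet.iUnion fun k => MeasurableSet.prod ?_ (measurableSet_eq _ x)
    exact (Nat.measurable_floor.comp (measurable_real_toNNReal.mul_const _))
      (measurableSet_singleton k)
  have : {p : ℝ × PathSpace E | X p.1.toNNReal p.2 = x} =
      ⋃ M : ℕ, ⋂ m : ℕ, ⋂ _ : M ≤ m, {p : ℝ × PathSpace E | X (q m p.1) p.2 = x} := by
    ext ⟨t, ω⟩
    simp only [Set.mem_ofPred_eq, Set.mem_iUnion, Set.mem_iInter]
    have hev : ∀ᶠ m in atTop, X (q m t) ω = X t.toNNReal ω := (hq t).eventually (ω.2.1 _)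
    rw [← eventually_atTop]
    refine ⟨fun h => hev.mono fun m hm => hm.trans h, fun h => ?_⟩
    obtain ⟨m, hm, hm'⟩ := (hev.and h).exists
    exact hm.symm.trans hm'
  rw [this]
  exact MeasurableSet.iUnion fun M => MeasurableSet.iInter fun m => MeasurableSet.iInter fun _ => hS m

end PathSpace

/-! ### Comparison with the Green function and the maximum principle -/

section
variable {Q : JumpRates E} {P : E → Measure (PathSpace E)}

namespace IsMarkovProcess

lemma measurable_transProb (hP : IsMarkovProcess Q P) (y x : E) :
    Measurable fun s : ℝ => transProb P s.toNNReal y x := by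
  have := hP.isProbabilityMeasure y
  exact (measurable_measure_prodMk_left (ν := P y) (measurableSet_prod_eq x)).ennreal_toReal

lemma intervalIntegrable_transProb (hP : IsMarkovProcess Q P) (y x : E) (a b : ℝ) :
    IntervalIntegrable (fun s : ℝ => transProb P s.toNNReal y x) volume a b := by
  refine (intervalIntegrable_const (c := (1 : ℝ))).mono_fun
    (hP.measurable_transProb y x).aestronglyMeasurable (ae_of_all _ fun s => ?_)
  simpa [abs_of_nonneg (transProb_nonneg _ _ _)] using hP.transProb_le_one _ _ _

lemma green_eq (hP : IsMarkovProcess Q P) (y x : E) :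
    green P y x = ∫⁻ s in Set.Ici (0 : ℝ), P y {ω | X s.toNNReal ω = x} := by
  have := hP.isProbabilityMeasure y
  have hmeas : Measurable (fun p : PathSpace E × ℝ =>
      Set.indicator {s : ℝ | X s.toNNReal p.1 = x} (1 : ℝ → ℝ≥0∞) p.2) := by
    have h : MeasurableSet {p : PathSpace E × ℝ | X p.2.toNNReal p.1 = x} :=
      measurable_swap (measurableSet_prod_eq x)
    exact (measurable_one (β := PathSpace E × ℝ) (α := ℝ≥0∞)).indicator h
  unfold green
  rw [lintegral_lintegral_swap hmeas.aemeasurable]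
  refine lintegral_congr fun s => ?_
  rw [← lintegral_indicator_one (measurableSet_eq s.toNNReal x)]
  rfl

lemma ofReal_integral_transProb_le_green (hP : IsMarkovProcess Q P) (y x : E) (T : ℝ≥0) :
    ENNReal.ofReal (∫ s in (0 : ℝ)..T, transProb P s.toNNReal y x) ≤ green P y x := by
  rw [hP.green_eq, intervalIntegral.integral_of_le (NNReal.coe_nonneg T), ofReal_integral_eq_lintegral_ofReal
    (hP.intervalIntegrable_transProb y x 0 T).1 (ae_of_all _ fun s => transProb_nonneg _ _ _)]
  simp_rw [hP.ofReal_transProb]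
  exact lintegral_mono_set fun s hs => hs.1.le

lemma semigroup_zero (hP : IsMarkovProcess Q P) (v : E → ℝ) (y : E) :
    semigroup P 0 v y = v y := by
  have := hP.isProbabilityMeasure y
  unfold semigroup
  rw [integral_congr_ae (g := fun _ => v y) ((hP.start y).mono fun ω h => by simp only [h])]
  simp

-- On the finite set `A` the generator limit is uniform, up to `ε`; off `A`, `v` is zero and `P_h v`
-- is nonnegative.
open Classical in
lemma exists_le_semigroup (hP : IsMarkovProcess Q P) {A : Finset E} {v : E → ℝ}
    (hv : v ∈ vanishingOff A) (hv0 : 0 ≤ v) {x : E} {c : ℝ} (hc : 0 ≤ c)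
    (hgen : ∀ y ∈ A, -(if y = x then c else 0) ≤ generator Q.rate v y) {ε : ℝ} (hε : 0 < ε) :
    ∃ h₀ : ℝ≥0, 0 < h₀ ∧ ∀ h : ℝ≥0, 0 < h → h < h₀ → ∀ y,
      v y - h * ((if y = x then c else 0) + ε) ≤ semigroup P h v y := by
  have h1 : ∀ᶠ h : ℝ≥0 in 𝓝[>] 0, ∀ y ∈ A,
      -((if y = x then c else 0) + ε) ≤ (semigroup P h v y - v y) / h := by
    refine (eventually_all_finset A).2 fun y hy => ?_
    refine (hP.tendsto_semigroup hv y).eventually_const_le ?_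
    have := hgen y hy
    linarith
  obtain ⟨h₀, hpos, hh⟩ := mem_nhdsGT_iff_exists_Ioo_subset.1 h1
  refine ⟨h₀, hpos, fun h h0 hlt y => ?_⟩
  by_cases hy : y ∈ A
  · have h2 := hh ⟨h0, hlt⟩ y hy
    rw [le_div_iff₀ (by exact_mod_cast h0)] at h2
    linarith
  · rw [hv y hy]
    have h2 : 0 ≤ semigroup P h v y := integral_nonneg fun ω => hv0 _
    have h3 : 0 ≤ (h : ℝ) * ((if y = x then c else 0) + ε) := by
      refine mul_nonneg h.2 ?_
      split_ifs <;> linarith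
    linarith

-- Average the one-step bound over the law of `X_s` and use the semigroup property.
open Classical in
lemma le_semigroup_add (hP : IsMarkovProcess Q P) {A : Finset E} {v : E → ℝ}
    (hv : v ∈ vanishingOff A) {x : E} {c ε : ℝ} {h : ℝ≥0}
    (hstep : ∀ y, v y - h * ((if y = x then c else 0) + ε) ≤ semigroup P h v y)
    (s : ℝ≥0) (y : E) :
    semigroup P s v y - h * (c * transProb P s y x + ε) ≤ semigroup P (s + h) v y := by
  have := hP.isProbabilityMeasure y
  have hbdd : ∀ (u : E → ℝ), u ∈ vanishingOff A → ∀ z, |u z| ≤ ∑ a ∈ A, |u a| := by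
    intro u hu z
    by_cases hz : z ∈ A
    · exact Finset.single_le_sum (f := fun a => |u a|) (fun a _ => abs_nonneg _) hz
    · rw [hu z hz, abs_zero]
      exact Finset.sum_nonneg fun a _ => abs_nonneg _
  have hint : Integrable (fun ω => v (X s ω)) (P y) := hP.integrable_comp s y v (hbdd v hv)
  have hx : (fun z => if z = x then c else 0) ∈ vanishingOff {x} := by
    intro z hz
    simp only [Finset.mem_singleton] at hz
    simp [hz]
  have hint' : Integrable (fun ω => if X s ω = x then c else 0) (P y) :=
    hP.integrable_comp s y (fun z => if z = x then c else 0) (C := |c|) fun z => by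
      split_ifs <;> simp
  have hsg : ∀ z, |semigroup P h v z| ≤ ∑ a ∈ A, |v a| := by
    intro z
    rw [hP.semigroup_eq_sum hv]
    refine (Finset.abs_sum_le_sum_abs _ _).trans (Finset.sum_le_sum fun a _ => ?_)
    rw [abs_mul, abs_of_nonneg (transProb_nonneg _ _ _)]
    exact mul_le_of_le_one_right (abs_nonneg _) (hP.transProb_le_one _ _ _)
  have hind : ∫ ω, (if X s ω = x then c else 0) ∂(P y) = c * transProb P s y x := by
    have := hP.semigroup_eq_sum hx s y
    rw [Finset.sum_singleton, if_pos rfl] at this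
    exact this
  have hint₂ : Integrable (fun ω => (h : ℝ) * ((if X s ω = x then c else 0) + ε)) (P y) :=
    (hint'.add (integrable_const ε)).const_mul _
  rw [hP.semigroup_add hv]
  calc semigroup P s v y - h * (c * transProb P s y x + ε)
      = ∫ ω, (v (X s ω) - h * ((if X s ω = x then c else 0) + ε)) ∂(P y) := by
        rw [integral_sub hint hint₂, integral_const_mul,
          integral_add hint' (integrable_const ε), hind]
        simp [semigroup]
    _ ≤ _ := integral_mono (hint.sub hint₂)
        (hP.integrable_comp s y _ hsg) fun ω => hstep _

open Classical in
/-- A nonnegative function `v` of finite support with `L v ≥ -c 1_{x}` is dominated by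
`P_T v + c ∫₀ᵀ p_s(·, x) ds`. -/
theorem le_semigroup_add_integral (hP : IsMarkovProcess Q P) {A : Finset E} {v : E → ℝ}
    (hv : v ∈ vanishingOff A) (hv0 : 0 ≤ v) {x : E} {c : ℝ} (hc : 0 ≤ c)
    (hgen : ∀ y ∈ A, -(if y = x then c else 0) ≤ generator Q.rate v y) (y : E) (T : ℝ≥0) :
    v y ≤ semigroup P T v y + c * ∫ s in (0 : ℝ)..T, transProb P s.toNNReal y x := by
  -- Iterating the one-step bound gives a Riemann sum. The factor `1 - ε` turns it into the integral
  -- without continuity in time: `p_s(y,x) ≥ p_{kh}(y,x) p_{s-kh}(x,x)` on each step.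
  have key : ∀ ε : ℝ, 0 < ε → ε < 1 → (1 - ε) * (v y - semigroup P T v y - ε * T) ≤
      c * ∫ s in (0 : ℝ)..T, transProb P s.toNNReal y x := by
    intro ε hε hε1
    rcases eq_or_lt_of_le (zero_le (a := T)) with rfl | hT
    · simp [hP.semigroup_zero]
    obtain ⟨h₁, h₁pos, hstep⟩ := hP.exists_le_semigroup hv hv0 hc hgen hε
    obtain ⟨C, hC, h₂, h₂pos, hself⟩ := hP.exists_le_transProb_self x
    obtain ⟨n, hn0, hn1, hn2, hn3⟩ : ∃ n : ℕ, 0 < n ∧ T / n < h₁ ∧ T / n < h₂ ∧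
        C * (T / n : ℝ≥0) ≤ ε := by
      have hlim : Tendsto (fun n : ℕ => T / (n : ℝ≥0)) atTop (𝓝 0) :=
        tendsto_const_div_atTop_nhds_zero_nat T
      have hlim2 : Tendsto (fun n : ℕ => C * (T / n : ℝ≥0)) atTop (𝓝 (C * (0 : ℝ≥0))) :=
        ((NNReal.continuous_coe.tendsto 0).comp hlim).const_mul C
      obtain ⟨n, ⟨⟨h1, h2⟩, h3⟩, h4⟩ := (((hlim.eventually_lt_const h₁pos).and
        (hlim.eventually_lt_const h₂pos)).and
        (hlim2.eventually_le_const (by simpa using hε))).and (eventually_gt_atTop 0) |>.exists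
      exact ⟨n, h4, h1, h2, h3⟩
    set h : ℝ≥0 := T / n
    have hpos : 0 < h := by positivity
    have hind : ∀ k : ℕ, (1 - ε) * (v y - semigroup P (k * h) v y - ε * (k * h : ℝ≥0)) ≤
        c * ∫ s in (0 : ℝ)..(k * h : ℝ≥0), transProb P s.toNNReal y x := by
      intro k
      induction k with
      | zero => simp [hP.semigroup_zero]
      | succ k ih =>
        have e : ((k + 1 : ℕ) : ℝ≥0) * h = k * h + h := by push_cast; ring
        rw [e]
        have h1 := hP.le_semigroup_add hv (hstep h hpos hn1) (k * h) y
        have h2 : (1 - ε) * (h * transProb P (k * h) y x) ≤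
            ∫ s in ((k * h : ℝ≥0) : ℝ)..(k * h + h : ℝ≥0), transProb P s.toNNReal y x := by
          have hle : ((k * h : ℝ≥0) : ℝ) ≤ (k * h + h : ℝ≥0) := by
            exact_mod_cast le_self_add
          have hconst : ∫ _ in ((k * h : ℝ≥0) : ℝ)..(k * h + h : ℝ≥0),
              (1 - ε) * transProb P (k * h) y x = (1 - ε) * (h * transProb P (k * h) y x) := by
            rw [intervalIntegral.integral_const]
            push_cast
            rw [smul_eq_mul]
            ring
          rw [← hconst]
          refine intervalIntegral.integral_mono_on hle intervalIntegrable_const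
            (hP.intervalIntegrable_transProb y x _ _) fun s hs => ?_
          lift s to ℝ≥0 using (NNReal.coe_nonneg _).trans hs.1
          rw [Real.toNNReal_coe]
          obtain ⟨hs1, hs2⟩ := hs
          rw [NNReal.coe_le_coe] at hs1 hs2
          obtain ⟨u, rfl⟩ := exists_add_of_le hs1
          have hu : u ≤ h := le_of_add_le_add_left hs2
          have h3 := hself u (hu.trans_lt hn2)
          have h4 : C * u ≤ C * h := mul_le_mul_of_nonneg_left (by exact_mod_cast hu) hC.le
          refine le_trans ?_ (hP.mul_transProb_le (k * h) u y x x)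
          rw [mul_comm]
          exact mul_le_mul_of_nonneg_left (by linarith) (transProb_nonneg _ _ _)
        have h3 := intervalIntegral.integral_add_adjacent_intervals
          (hP.intervalIntegrable_transProb y x 0 (k * h : ℝ≥0))
          (hP.intervalIntegrable_transProb y x (k * h : ℝ≥0) (k * h + h : ℝ≥0))
        rw [← h3, mul_add]
        have h4 := mul_le_mul_of_nonneg_left h1 (show 0 ≤ 1 - ε by linarith)
        have h5 := mul_le_mul_of_nonneg_left h2 hc
        have h6 := NNReal.coe_add (k * h) h
        linear_combination ih + h4 + h5 - (1 - ε) * ε * h6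
    have := hind n
    rwa [mul_div_cancel₀ _ (by positivity)] at this
  have hlim : Tendsto (fun ε : ℝ => (1 - ε) * (v y - semigroup P T v y - ε * T)) (𝓝[>] 0)
      (𝓝 ((1 - 0) * (v y - semigroup P T v y - 0 * T))) := by
    refine tendsto_nhdsWithin_of_tendsto_nhds (Continuous.tendsto ?_ 0)
    fun_prop
  have := le_of_tendsto hlim (by
    filter_upwards [Ioo_mem_nhdsGT (show (0 : ℝ) < 1 by norm_num)] with ε hε
    exact key ε hε.1 hε.2)
  linarith

/-- The maximum principle for a transient irreducible process. -/
theorem eq_zero_of_generator_nonneg (hP : IsMarkovProcess Q P) (hQ : Q.Irreducible)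
    (ht : IsTransient P) {A : Finset E} {v : E → ℝ} (hv : v ∈ vanishingOff A) (hv0 : 0 ≤ v)
    (hgen : ∀ y ∈ A, 0 ≤ generator Q.rate v y) : v = 0 := by
  funext y
  refine le_antisymm ?_ (hv0 y)
  -- The comparison with `c = 0` reads `v ≤ P_T v`, and the right side tends to zero.
  refine ge_of_tendsto' (hP.tendsto_semigroup_atTop hQ ht hv y) fun T => ?_
  simpa using hP.le_semigroup_add_integral hv hv0 (x := y) le_rfl (by simpa using hgen) y T

end IsMarkovProcess
end

/-! ### Adjointness on finitely supported functions -/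

lemma pairing_eq_sum (μ : E → ℝ≥0) (g : E → ℝ) {A : Finset E} {H : E → ℝ}
    (hH : H ∈ vanishingOff A) : pairing μ g H = ∑ y ∈ A, (μ y : ℝ) * g y * H y :=
  tsum_eq_sum fun y hy => by rw [hH y hy, mul_zero]

lemma pairing_comm (μ : E → ℝ≥0) (f g : E → ℝ) : pairing μ f g = pairing μ g f :=
  tsum_congr fun _ => by ring

/-- Invariance enters here: it says that the reversed rates out of `y` also add up to `λ(y)`, so `L`
and `L*` have the same diagonal. -/
lemma mul_adjointGenerator {Q : JumpRates E} {μ : E → ℝ≥0} (hpos : ∀ y, 0 < μ y)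
    (hinv : ∀ j, HasSum (fun l => (μ l * Q.rate l j : ℝ)) (μ j * ∑' z, (Q.rate j z : ℝ)))
    {A : Finset E} {f : E → ℝ} (hf : f ∈ vanishingOff A) (y : E) :
    (μ y : ℝ) * adjointGenerator μ Q.rate f y =
      (∑ z ∈ A, (μ z : ℝ) * Q.rate z y * f z) - μ y * (∑' z, (Q.rate y z : ℝ)) * f y := by
  have h1 : HasSum (fun z => (μ z : ℝ) * Q.rate z y * f z)
      (∑ z ∈ A, (μ z : ℝ) * Q.rate z y * f z) :=
    hasSum_sum_of_ne_finset_zero fun z hz => by rw [hf z hz, mul_zero]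
  rw [← (h1.sub ((hinv y).mul_right (f y))).tsum_eq, adjointGenerator, generator, ← tsum_mul_left]
  refine tsum_congr fun z => ?_
  have : (μ y : ℝ) ≠ 0 := by exact_mod_cast (hpos y).ne'
  rw [adjointRate]
  push_cast
  field_simp

/-- `L*` is adjoint to `L` on finitely supported functions. -/
lemma pairing_adjointGenerator {Q : JumpRates E} {μ : E → ℝ≥0} (hpos : ∀ y, 0 < μ y)
    (hinv : ∀ j, HasSum (fun l => (μ l * Q.rate l j : ℝ)) (μ j * ∑' z, (Q.rate j z : ℝ)))
    {A : Finset E} {f H : E → ℝ} (hf : f ∈ vanishingOff A) (hH : H ∈ vanishingOff A) :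
    pairing μ (adjointGenerator μ Q.rate f) H = pairing μ f (generator Q.rate H) := by
  rw [pairing_comm μ f, pairing_eq_sum μ _ hH, pairing_eq_sum μ _ hf]
  simp_rw [mul_adjointGenerator hpos hinv hf, generator_eq_sum Q hH, mul_sub, sub_mul,
    Finset.sum_sub_distrib, Finset.mul_sum, Finset.sum_mul]
  rw [Finset.sum_comm]
  congr 1
  · exact Finset.sum_congr rfl fun z _ => Finset.sum_congr rfl fun y _ => by ring
  · exact Finset.sum_congr rfl fun z _ => by ring

/-- The quadratic form of an operator sees only its symmetric part. -/
lemma pairing_neg_symmetricGenerator {Q : JumpRates E} {μ : E → ℝ≥0} (hpos : ∀ y, 0 < μ y)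
    (hinv : ∀ j, HasSum (fun l => (μ l * Q.rate l j : ℝ)) (μ j * ∑' z, (Q.rate j z : ℝ)))
    {A : Finset E} {H : E → ℝ} (hH : H ∈ vanishingOff A) :
    pairing μ H (-symmetricGenerator μ Q.rate H) = -pairing μ H (generator Q.rate H) := by
  have h := pairing_adjointGenerator hpos hinv hH hH
  rw [pairing_comm μ H (generator Q.rate H)] at h ⊢
  rw [pairing_comm μ H, pairing_eq_sum μ _ hH]
  rw [pairing_eq_sum μ _ hH, pairing_eq_sum μ _ hH] at h
  rw [pairing_eq_sum μ _ hH]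
  have : ∀ y, (μ y : ℝ) * (-symmetricGenerator μ Q.rate H) y * H y =
      -(μ y * generator Q.rate H y * H y) / 2 -
        (μ y * adjointGenerator μ Q.rate H y * H y) / 2 := by
    intro y
    simp only [Pi.neg_apply, symmetricGenerator]
    ring
  simp_rw [this]
  rw [Finset.sum_sub_distrib, ← Finset.sum_div, ← Finset.sum_div, Finset.sum_neg_distrib, h]
  ring

/-! ### The Dirichlet problem on a finite set -/

section
variable {Q : JumpRates E} {P : E → Measure (PathSpace E)}

/-- The Dirichlet problem for the generator on a finite set is solvable. -/
theorem IsMarkovProcess.exists_generator_eq (hP : IsMarkovProcess Q P) (hQ : Q.Irreducible)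
    (ht : IsTransient P) (A : Finset E) (φ : E → ℝ) :
    ∃ g ∈ vanishingOff A, ∀ y ∈ A, generator Q.rate g y = φ y := by
  classical
  let ext : (A → ℝ) → E → ℝ := fun u y => if h : y ∈ A then u ⟨y, h⟩ else 0
  have hext : ∀ u, ext u ∈ vanishingOff A := fun u y hy => dif_neg hy
  have hext' : ∀ u (a : A), ext u a = u a := fun u a => dif_pos a.2
  let T : (A → ℝ) →ₗ[ℝ] (A → ℝ) :=
    { toFun := fun u a => (∑ b : A, (Q.rate a b : ℝ) * u b) - (∑' z, (Q.rate a z : ℝ)) * u a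
      map_add' := fun u v => by
        ext a
        simp only [Pi.add_apply, mul_add, Finset.sum_add_distrib]
        ring
      map_smul' := fun c u => by
        ext a
        simp only [Pi.smul_apply, smul_eq_mul, RingHom.id_apply, mul_sub, Finset.mul_sum]
        congr 1
        · exact Finset.sum_congr rfl fun b _ => by ring
        · ring }
  have hT : ∀ u (a : A), generator Q.rate (ext u) a = T u a := by
    intro u a
    rw [generator_eq_sum Q (hext u), ← Finset.sum_coe_sort A, hext']
    simp_rw [hext']
    rfl
  -- In finite dimension uniqueness suffices. If `L u = 0` on `A`, then `L |u| ≥ 0` there by the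
  -- triangle inequality, and the maximum principle applies to `|u|`.
  have hinj : Function.Injective T := by
    refine (injective_iff_map_eq_zero T).2 fun u hu => ?_
    have habs : (fun y => |ext u y|) ∈ vanishingOff A := fun y hy => by
      simp only [hext u y hy, abs_zero]
    have h0 := hP.eq_zero_of_generator_nonneg hQ ht habs (fun y => abs_nonneg _) fun y hy => by
      have h1 : generator Q.rate (ext u) y = 0 := (hT u ⟨y, hy⟩).trans (congrFun hu _)
      rw [generator_eq_sum Q (hext u), sub_eq_zero] at h1
      rw [generator_eq_sum Q habs, sub_nonneg]
      have hc : 0 ≤ ∑' z, (Q.rate y z : ℝ) := tsum_nonneg fun _ => NNReal.coe_nonneg _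
      rw [← abs_of_nonneg hc, ← abs_mul, ← h1]
      refine (Finset.abs_sum_le_sum_abs _ _).trans (le_of_eq (Finset.sum_congr rfl fun z _ => ?_))
      rw [abs_mul, NNReal.abs_eq]
    ext a
    rw [← hext' u a]
    exact abs_eq_zero.1 (congrFun h0 a)
  obtain ⟨u, hu⟩ := LinearMap.injective_iff_surjective.1 hinj fun a => φ a
  exact ⟨ext u, hext u, fun y hy => (hT u ⟨y, hy⟩).trans (congrFun hu _)⟩

open Classical in
/-- The Green function of the process killed outside a finite set is dominated by the Green
function of the process on the diagonal. -/
theorem IsMarkovProcess.exists_dirichlet_green (hP : IsMarkovProcess Q P) (hQ : Q.Irreducible)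
    (ht : IsTransient P) {A : Finset E} {x : E} (hx : x ∈ A) :
    ∃ g ∈ vanishingOff A, (∀ y ∈ A, generator Q.rate g y = -(if y = x then 1 else 0)) ∧
      0 < g x ∧ ENNReal.ofReal (g x) ≤ green P x x := by
  obtain ⟨g, hg, hgen⟩ := hP.exists_generator_eq hQ ht A fun y => -(if y = x then 1 else 0)
  have hneg : (fun y => max (-g y) 0) ∈ vanishingOff A := fun y hy => by
    simp only [hg y hy, neg_zero, max_self]
  have hg0 : 0 ≤ g := by
    -- As `L g ≤ 0` on `A`, the negative part of `g` is subharmonic there, hence zero.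
    have h0 := hP.eq_zero_of_generator_nonneg hQ ht hneg (fun y => le_max_right _ _) fun y hy => by
      have h1 := hgen y hy
      rw [generator_eq_sum Q hg] at h1
      rw [generator_eq_sum Q hneg]
      rcases le_total 0 (g y) with hy0 | hy0
      · rw [max_eq_right (by linarith), mul_zero, sub_zero]
        exact Finset.sum_nonneg fun z _ => mul_nonneg (NNReal.coe_nonneg _) (le_max_right _ _)
      · rw [max_eq_left (by linarith)]
        have h2 : ∑ z ∈ A, (Q.rate y z : ℝ) * -g z ≤ ∑ z ∈ A, (Q.rate y z : ℝ) * max (-g z) 0 :=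
          Finset.sum_le_sum fun z _ =>
            mul_le_mul_of_nonneg_left (le_max_left _ _) (NNReal.coe_nonneg _)
        simp only [mul_neg, Finset.sum_neg_distrib] at h2
        have h3 : (0 : ℝ) ≤ if y = x then 1 else 0 := by split_ifs <;> norm_num
        linarith
    intro y
    have := congrFun h0 y
    have h2 : -g y ≤ max (-g y) 0 := le_max_left _ _
    simp only [Pi.zero_apply] at this ⊢
    linarith
  refine ⟨g, hg, hgen, ?_, ?_⟩
  -- If `g x = 0`, then `L g (x) ≥ 0` since `g ≥ 0`, against the value `-1`.
  · refine lt_of_le_of_ne (hg0 x) fun h => ?_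
    have h1 := hgen x hx
    rw [generator_eq_sum Q hg, ← h, if_pos rfl, mul_zero, sub_zero] at h1
    have h2 : 0 ≤ ∑ z ∈ A, (Q.rate x z : ℝ) * g z :=
      Finset.sum_nonneg fun z _ => mul_nonneg (NNReal.coe_nonneg _) (hg0 z)
    linarith
  · by_cases htop : green P x x = ∞
    · rw [htop]
      exact le_top
    rw [ENNReal.ofReal_le_iff_le_toReal htop]
    have hlim := (hP.tendsto_semigroup_atTop hQ ht hg x).add_const (green P x x).toReal
    rw [zero_add] at hlim
    refine ge_of_tendsto' hlim fun T => ?_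
    have h1 := hP.le_semigroup_add_integral hg hg0 (x := x) zero_le_one
      (fun y hy => (hgen y hy).ge) x T
    have h2 := hP.ofReal_integral_transProb_le_green x x T
    rw [ENNReal.ofReal_le_iff_le_toReal htop] at h2
    linarith

end

/-! ### The variational problem and the conclusion -/

lemma variationalSup_mono (μ : E → ℝ≥0) (r : E → E → ℝ≥0) (f : E → ℝ) :
    Monotone (variationalSup μ r f) := by
  intro A B h
  exact biSup_mono fun H hH y hy => hH y fun h' => hy (h h')

lemma le_variationalSup {Q : JumpRates E} {μ : E → ℝ≥0} (hpos : ∀ y, 0 < μ y)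
    (hinv : ∀ j, HasSum (fun l => (μ l * Q.rate l j : ℝ)) (μ j * ∑' z, (Q.rate j z : ℝ)))
    {A : Finset E} {f H : E → ℝ} (hf : f ∈ vanishingOff A) (hH : H ∈ vanishingOff A) :
    ((2 * pairing μ f (generator Q.rate H) + pairing μ H (generator Q.rate H) : ℝ) : EReal) ≤
      variationalSup μ Q.rate f A := by
  rw [← pairing_adjointGenerator hpos hinv hf hH, ← sub_neg_eq_add,
    ← pairing_neg_symmetricGenerator hpos hinv hH]
  exact le_biSup (fun H => ((2 * pairing μ (adjointGenerator μ Q.rate f) H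
      - pairing μ H (-symmetricGenerator μ Q.rate H) : ℝ) : EReal)) hH

open Classical in
/-- The value of the variational problem at the optimal multiple of the Dirichlet Green
function. -/
lemma div_le_variationalSup {Q : JumpRates E} {μ : E → ℝ≥0} (hpos : ∀ y, 0 < μ y)
    (hinv : ∀ j, HasSum (fun l => (μ l * Q.rate l j : ℝ)) (μ j * ∑' z, (Q.rate j z : ℝ)))
    {A : Finset E} {f g : E → ℝ} (hf : f ∈ vanishingOff A) (hg : g ∈ vanishingOff A) {x : E}
    (hx : x ∈ A) (hgen : ∀ y ∈ A, generator Q.rate g y = -(if y = x then 1 else 0))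
    (hgx : 0 < g x) :
    ((μ x * f x ^ 2 / g x : ℝ) : EReal) ≤ variationalSup μ Q.rate f A := by
  -- The maximiser of the concave quadratic `-μ(x) (2 c f(x) + c² g(x))`.
  set c : ℝ := -(f x / g x)
  have hH : (fun y => c * g y) ∈ vanishingOff A := fun y hy => by simp only [hg y hy, mul_zero]
  have hgenH : ∀ y ∈ A, generator Q.rate (fun y => c * g y) y = if y = x then -c else 0 := by
    intro y hy
    have : generator Q.rate (fun y => c * g y) y = c * generator Q.rate g y := by
      rw [generator, generator, ← tsum_mul_left]
      exact tsum_congr fun z => by ring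
    rw [this, hgen y hy]
    split_ifs <;> ring
  have hpair : ∀ u ∈ vanishingOff A,
      pairing μ u (generator Q.rate (fun y => c * g y)) = -c * (μ x * u x) := by
    intro u hu
    rw [pairing_comm, pairing_eq_sum μ _ hu, Finset.sum_congr rfl fun y hy => by rw [hgenH y hy]]
    simp only [mul_ite, ite_mul, mul_zero, zero_mul, Finset.sum_ite_eq', hx, if_true]
    ring
  refine le_trans (le_of_eq ?_) (le_variationalSup hpos hinv hf hH)
  rw [hpair f hf, hpair _ hH]
  congr 1
  simp only [c]
  field_simp
  ring

end MarkovChain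

theorem lemma2p6 {E : Type*} [Countable E]
    (Q : MarkovChain.JumpRates E) (hirr : Q.Irreducible)
    (P : E → Measure (MarkovChain.PathSpace E)) (hP : MarkovChain.IsMarkovProcess Q P)
    (μ : E → ℝ≥0) (hμ : MarkovChain.IsStationary P μ)
    (htrans : MarkovChain.IsTransient P)
    (f : E → ℝ) (hf : f.support.Finite)
    (A : ℕ → Finset E) (hA : Monotone A) (hcover : ∀ y, ∃ n, y ∈ A n)
    (x : E) :
    ∃ ℓ : EReal,
      Tendsto (fun n => MarkovChain.variationalSup μ Q.rate f (A n)) atTop (𝓝 ℓ) ∧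
        (((μ x : ℝ) * f x ^ 2 : ℝ) : EReal) ≤ (MarkovChain.green P x x : EReal) * ℓ := by
  classical
  have hmono : Monotone fun n => MarkovChain.variationalSup μ Q.rate f (A n) :=
    (MarkovChain.variationalSup_mono μ Q.rate f).comp hA
  refine ⟨_, tendsto_atTop_iSup hmono, ?_⟩
  -- A single large `n` suffices, since the limit is the supremum over `n`.
  obtain ⟨n, hn⟩ : ∃ n, insert x hf.toFinset ⊆ A n :=
    ((tendsto_atTop_finset_of_monotone hA hcover).eventually_ge_atTop _).exists
  have hx : x ∈ A n := hn (Finset.mem_insert_self _ _)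
  have hfA : f ∈ MarkovChain.vanishingOff (A n) := fun y hy => by
    by_contra h
    exact hy (hn (Finset.mem_insert_of_mem (hf.mem_toFinset.2 h)))
  obtain ⟨g, hg, hgen, hgx, hgreen⟩ := hP.exists_dirichlet_green hirr htrans hx
  have hle := (MarkovChain.div_le_variationalSup (hμ.pos hP hirr) (hμ.hasSum_rate hP hA hcover)
    hfA hg hx hgen hgx).trans (le_iSup (fun n => MarkovChain.variationalSup μ Q.rate f (A n)) n)
  have hgreen' : ((g x : ℝ) : EReal) ≤ (MarkovChain.green P x x : EReal) := by
    rw [← max_eq_left hgx.le, ← EReal.coe_ennreal_ofReal]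
    exact EReal.coe_ennreal_le_coe_ennreal_iff.2 hgreen
  -- Multiplying inequalities in `EReal` needs this sign, `G(x,x)` and the limit being possibly
  -- infinite.
  have h0 : (0 : EReal) ≤ ((μ x * f x ^ 2 / g x : ℝ) : EReal) := by
    exact_mod_cast div_nonneg (mul_nonneg (NNReal.coe_nonneg _) (sq_nonneg _)) hgx.le
  calc (((μ x : ℝ) * f x ^ 2 : ℝ) : EReal)
      = ((g x : ℝ) : EReal) * ((μ x * f x ^ 2 / g x : ℝ) : EReal) := by
        rw [← EReal.coe_mul, mul_div_cancel₀ _ hgx.ne']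
    _ ≤ _ := mul_le_mul hgreen' hle h0 (EReal.coe_ennreal_nonneg _)
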